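/- A labeled hypergraph on $[n]=\{1,\dots,n\}$ with edge numbers $\ell=(\ell_2,\ell_3,\dots)$ (finitely many nonzero) consists, for each $i\ge 2$, of $\ell_i$ edges labeled by $[\ell_i]$, each an $i$-element subset of $[n]$; repeated edges are allowed. It is connected if $n\ge 1$ and any two vertices are joined by a path. Let $u_2,u_3,\dots$ be indeterminates, $u^\ell/\ell!=\prod_i u_i^{\ell_i}/\ell_i!$, and call $\sum_{i\ge2}(i-1)\ell_i$ the magnitude of $u^\ell$. Let $$C=\sum_{n\ge1}\frac{t^n}{n!}C_n(u_2,u_3,\dots)$$ be the exponential generating function of connected labeled hypergraphs, i.e. the coefficient of $u^\ell/\ell!$ in $C_n$ is the number of connected labeled hypergraphs on $[n]$ with edge numbers $\ell$. Let $T_n$ be the sum of all terms of magnitude $n-1$ in $C_n$, and put $$T=\sum_{n\ge1}\frac{t^n}{n!}T_n,\qquad R=t\,\frac{\partial T}{\partial t}.$$ Then, for every $n\ge1$, $$\left[\frac{t^n}{n!}\right]R=\sum_{\lambda\vdash n-1}\binom{n-1}{\lambda_1,\lambda_2,\dots}\prod_{i\ge1}\frac{(n\,u_{i+1})^{a_i}}{a_i!},$$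 where $\lambda$ runs over the partitions of $n-1$, $\lambda_1,\lambda_2,\dots$ are its parts, and $a_i$ is the number of parts of size $i$. Moreover $\left[\frac{t^n}{n!}\right]T=\frac1n\left[\frac{t^n}{n!}\right]R$ for every $n\ge1$, and $$\begin{aligned} \left[\tfrac{t}{1!}\right]T&=1,\\ \left[\tfrac{t^2}{2!}\right]T&=u_2,\\ \left[\tfrac{t^3}{3!}\right]T&=u_3+3u_2^2,\\ \left[\tfrac{t^4}{4!}\right]T&=u_4+12u_2u_3+16u_2^3,\\ \left[\tfrac{t^5}{5!}\right]T&=u_5+20u_2u_4+15u_3^2+150u_3u_2^2+125u_2^4,\\ \left[\tfrac{t^6}{6!}\right]T&=u_6+30u_2u_5+60u_4u_3+360u_4u_2^2+540u_2u_3^2+2160u_3u_2^3+1296u_2^5. \end{aligned}$$ -/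

import Mathlib

open scoped Nat

noncomputable section

namespace Hyper

/-- A labeled hypergraph with vertex set `Fin n` having `ℓ i` edges of size `i` for each `i`,
the edges of size `i` being labeled by `Fin (ℓ i)`. Repeated edges are allowed; every edge has
at least two vertices. -/
structure LabeledHypergraph (n : ℕ) (ℓ : ℕ →₀ ℕ) where
  /-- The vertex set of the `i`-edge with label `j`. -/
  edge : (i : ℕ) → Fin (ℓ i) → Finset (Fin n)
  card_edge : ∀ i j, (edge i j).card = i
  two_le_card_edge : ∀ i j, 2 ≤ (edge i j).card

/-- There are only finitely many such hypergraphs, so that counting them is meaningful. -/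
theorem LabeledHypergraph.finite (n : ℕ) (ℓ : ℕ →₀ ℕ) : Finite (LabeledHypergraph n ℓ) := by
  have hE : Finite ((i : ℕ) × Fin (ℓ i)) := by
    refine Finite.of_injective
      (β := (i : ℓ.support) × Fin (ℓ i))
      (fun p => ⟨⟨p.1, Finsupp.mem_support_iff.2 fun h => (Fin.cast h p.2).elim0⟩, p.2⟩) ?_
    rintro ⟨i, j⟩ ⟨i', j'⟩ h
    simp only [Sigma.mk.injEq, Subtype.mk.injEq] at h
    obtain ⟨rfl, h⟩ := h
    simpa using h
  refine Finite.of_injective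
    (β := ((i : ℕ) × Fin (ℓ i)) → Finset (Fin n)) (fun H p => H.edge p.1 p.2) ?_
  rintro ⟨e, _, _⟩ ⟨e', _, _⟩ h
  have : e = e' := by
    funext i j
    exact congrFun h ⟨i, j⟩
  subst this
  rfl

/-- Two vertices are adjacent if some edge contains both. -/
def LabeledHypergraph.Adj {n : ℕ} {ℓ : ℕ →₀ ℕ} (H : LabeledHypergraph n ℓ) (v w : Fin n) : Prop :=
  ∃ i j, v ∈ H.edge i j ∧ w ∈ H.edge i j

/-- A hypergraph is connected if it has a vertex and any two vertices are joined by a walk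
(equivalently, by a path, as a shortest walk repeats no vertex and no edge). -/
def LabeledHypergraph.Connected {n : ℕ} {ℓ : ℕ →₀ ℕ} (H : LabeledHypergraph n ℓ) : Prop :=
  0 < n ∧ ∀ v w : Fin n, Relation.ReflTransGen H.Adj v w

/-- The number of connected labeled hypergraphs on `n` vertices with `ℓ i` edges of size `i`
for each `i`. It vanishes if `ℓ 0 ≠ 0` or `ℓ 1 ≠ 0`. -/
def numConnected (n : ℕ) (ℓ : ℕ →₀ ℕ) : ℕ :=
  Nat.card {H : LabeledHypergraph n ℓ // H.Connected}

/-- Formal power series over `ℚ` in the indeterminates `u_i`. -/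
abbrev Coeffs : Type := MvPowerSeries ℕ ℚ

/-- The indeterminate `u_i`, marking edges of size `i`. -/
def u (i : ℕ) : Coeffs := MvPowerSeries.X i

/-- `[t^n / n!] F`, for a power series `F` in `t`. -/
def egfCoeff (n : ℕ) (F : PowerSeries Coeffs) : Coeffs :=
  (n ! : ℚ) • PowerSeries.coeff n F

/-- The exponential generating function
`C = ∑ n ℓ, numConnected n ℓ * (t ^ n / n!) * (u ^ ℓ / ℓ!)` of connected labeled hypergraphs. -/
def C : PowerSeries Coeffs :=
  PowerSeries.mk fun n => (1 / (n ! : ℚ)) •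
    ((fun ℓ : ℕ →₀ ℕ => (numConnected n ℓ : ℚ) / ℓ.prod fun _ k => (k ! : ℚ)) : Coeffs)

/-- The magnitude `∑ i, (i - 1) * ℓ i` of the monomial `u ^ ℓ`. -/
def magnitude (ℓ : ℕ →₀ ℕ) : ℕ := ℓ.sum fun i k => (i - 1) * k

/-- The sum of all terms of magnitude `n - 1` in `[t^n / n!] C`. -/
def leadingPart (n : ℕ) : Coeffs :=
  fun ℓ : ℕ →₀ ℕ =>
    if magnitude ℓ + 1 = n then MvPowerSeries.coeff ℓ (egfCoeff n C) else 0

/-- The generating function `T` of the leading terms of `C`. -/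
def T : PowerSeries Coeffs :=
  PowerSeries.mk fun n => (1 / (n ! : ℚ)) • leadingPart n

/-- `R = t * ∂T/∂t`. -/
def R : PowerSeries Coeffs :=
  PowerSeries.X * PowerSeries.derivative Coeffs T

/-- The multinomial coefficient `m! / (λ₁! λ₂! ⋯)`, where `λ₁, λ₂, …` are the parts of the
partition `p` of `m`. -/
def multinomialOfParts {m : ℕ} (p : Nat.Partition m) : ℚ :=
  (m ! : ℚ) / (p.parts.map fun k => (k ! : ℚ)).prod

end Hyper

end

/-!
Contracting an edge to a point turns a connected hypergraph with one more edge into a connected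
hypergraph on the quotient, and it merges at most as many vertices as the edge has, so a connected
hypergraph on `n` vertices has magnitude at least `n - 1`. If the magnitude is `n - 1` exactly,
each edge must contain distinct points of the quotient reached when it is contracted.

To count these hypertrees edge by edge, one keeps the vertex set `V` and lets the quotient
`π : V → Q` vary, each point of `Q` being weighted by the number of vertices over it. If the edges
have `r i + 1` vertices with `∑ i, r i = |Q| - 1`, then the number of families of `k` edges that
connect `Q` is
`∏ q, |π ⁻¹ q| * |V| ^ (k - 1) * (∑ i, r i)! / ∏ i, (r i)!`.
Indeed, an edge over a set `S` of points can be chosen in `∏ q ∈ S, |π ⁻¹ q|` ways, and its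
contraction replaces the weights of the points of `S` by their sum; summing over all `S` of size
`r + 1` multiplies the product of all weights by `|V| * (|Q| - 1).choose r`.

For `Q = V` of size `n`, the numbers `r i` are the parts of a partition of `n - 1`.
-/

namespace Hyper

open Finset

section Connectivity

variable {ι κ Q : Type*}

/-- The hypergraph on `Q` with edges `f` joins any two vertices by a walk. Unlike
`LabeledHypergraph.Connected`, this holds if there are no vertices. -/
def EdgesConnect (f : ι → Finset Q) : Prop :=
  ∀ a b, Relation.ReflTransGen (fun a b => ∃ i, a ∈ f i ∧ b ∈ f i) a b

theorem edgesConnect_comp_equiv (e : ι ≃ κ) (f : κ → Finset Q) :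
    EdgesConnect (f ∘ e) ↔ EdgesConnect f := by
  simp only [EdgesConnect, Function.comp_apply, e.surjective.exists]

theorem edgesConnect_iff_subsingleton [IsEmpty ι] (f : ι → Finset Q) :
    EdgesConnect f ↔ Subsingleton Q := by
  refine ⟨fun h => ⟨fun a b => ?_⟩, fun _ a b => Subsingleton.elim a b ▸ .refl⟩
  rcases (h a b).cases_head with hab | ⟨_, ⟨i, _⟩, _⟩
  exacts [hab, isEmptyElim i]

section Contraction

variable [DecidableEq Q]

/-- The quotient map of `Q` that collapses the set `S` to the point `none`. -/
def contract (S : Finset Q) (q : Q) : Option {q // q ∉ S} :=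
  if h : q ∈ S then none else some ⟨q, h⟩

theorem contract_eq_none_iff {S : Finset Q} {q : Q} : contract S q = none ↔ q ∈ S := by
  simp [contract]

theorem contract_eq_some_iff {S : Finset Q} {q : Q} {r : {q // q ∉ S}} :
    contract S q = some r ↔ q = r := by
  unfold contract
  split_ifs with h
  · exact iff_of_false (by simp) fun hqr => r.2 (hqr ▸ h)
  · simp [Subtype.ext_iff]

theorem contract_eq_contract_iff {S : Finset Q} {q r : Q} :
    contract S q = contract S r ↔ q = r ∨ q ∈ S ∧ r ∈ S := by
  by_cases hr : r ∈ S
  · rw [contract_eq_none_iff.2 hr, contract_eq_none_iff]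
    grind
  · rw [show contract S r = some ⟨r, hr⟩ from contract_eq_some_iff.2 rfl, contract_eq_some_iff]
    simp [hr]

theorem contract_surjective {S : Finset Q} (hS : S.Nonempty) :
    Function.Surjective (contract S) := by
  rintro (_ | r)
  · exact hS.imp fun _ => contract_eq_none_iff.2
  · exact ⟨r, contract_eq_some_iff.2 rfl⟩

theorem card_contract_add_card [Fintype Q] (S : Finset Q) :
    Fintype.card (Option {q // q ∉ S}) + #S = Fintype.card Q + 1 := by
  rw [Fintype.card_option, Fintype.card_of_subtype Sᶜ fun _ => mem_compl, add_right_comm,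
    add_comm #Sᶜ, card_add_card_compl]

theorem edgesConnect_option_iff {f : Option ι → Finset Q} (hf : (f none).Nonempty) :
    EdgesConnect f ↔ EdgesConnect fun i => (f (some i)).image (contract (f none)) := by
  have hsurj := contract_surjective hf
  constructor
  · intro h c d
    obtain ⟨a, rfl⟩ := hsurj c
    obtain ⟨b, rfl⟩ := hsurj d
    refine Relation.ReflTransGen.lift' (contract (f none)) ?_ _ _ (h a b)
    rintro a b ⟨_ | i, ha, hb⟩
    · rw [Function.onFun, contract_eq_contract_iff.2 (.inr ⟨ha, hb⟩)]
    · exact .single ⟨i, mem_image_of_mem _ ha, mem_image_of_mem _ hb⟩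
  · intro h
    have joined_of_eq : ∀ {a b}, contract (f none) a = contract (f none) b →
        Relation.ReflTransGen (fun a b => ∃ i, a ∈ f i ∧ b ∈ f i) a b := by
      intro a b hab
      rcases contract_eq_contract_iff.1 hab with rfl | hab
      exacts [.refl, .single ⟨none, hab⟩]
    obtain ⟨g, hg⟩ := hsurj.hasRightInverse
    have joined_section : ∀ c d, Relation.ReflTransGen _ (g c) (g d) := fun c d => by
      refine Relation.ReflTransGen.lift' g ?_ _ _ (h c d)
      rintro c d ⟨i, hc, hd⟩
      obtain ⟨a, ha, rfl⟩ := mem_image.1 hc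
      obtain ⟨b, hb, rfl⟩ := mem_image.1 hd
      exact (joined_of_eq (hg _)).trans
        (.head ⟨some i, ha, hb⟩ (joined_of_eq (hg _).symm))
    exact fun a b => (joined_of_eq (hg _).symm).trans
      ((joined_section _ _).trans (joined_of_eq (hg _)))

end Contraction

theorem EdgesConnect.card_le [Fintype ι] [Fintype Q] {f : ι → Finset Q}
    (hf : ∀ i, (f i).Nonempty) (h : EdgesConnect f) :
    Fintype.card Q ≤ 1 + ∑ i, (#(f i) - 1) := by
  classical
  revert Q
  refine Fintype.induction_empty_option (P := fun ι _ => ∀ {Q} [Fintype Q]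
    {f : ι → Finset Q}, (∀ i, (f i).Nonempty) → EdgesConnect f →
      Fintype.card Q ≤ 1 + ∑ i, (#(f i) - 1)) ?_ ?_ ?_ ι
  · intro ι κ _ e ih Q _ f hf h
    let := Fintype.ofEquiv κ e.symm
    rw [← e.sum_comp]
    exact ih (fun i => hf (e i)) ((edgesConnect_comp_equiv e f).2 h)
  · intro Q _ f _ h
    simpa [Fintype.card_le_one_iff_subsingleton] using (edgesConnect_iff_subsingleton f).1 h
  · intro ι _ ih Q _ f hf h
    have card_contracted := ih (fun i => (hf (some i)).image _)
      ((edgesConnect_option_iff (hf none)).1 h)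
    have image_le : ∑ i, (#((f (some i)).image (contract (f none))) - 1) ≤
        ∑ i, (#(f (some i)) - 1) := sum_le_sum fun i _ => Nat.sub_le_sub_right card_image_le 1
    have := card_contract_add_card (f none)
    have := (hf none).card_pos
    rw [Fintype.sum_option]
    omega

end Connectivity

section Counting

variable {ι κ V Q : Type*} [DecidableEq Q]

/-- The number of families of edges `f i ⊆ V` with `r i + 1` vertices whose images under `π`
connect `Q`. The quotient `π` records the edges contracted so far, so that an induction on the
number of edges may keep the vertex set `V` fixed. -/
noncomputable def numConnecting (π : V → Q) (r : ι → ℕ) : ℕ :=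
  Nat.card {f : ι → Finset V // (∀ i, #(f i) = r i + 1) ∧ EdgesConnect fun i => (f i).image π}

theorem numConnecting_comp_equiv (π : V → Q) (e : ι ≃ κ) (r : κ → ℕ) :
    numConnecting π (r ∘ e) = numConnecting π r := by
  refine Nat.card_congr ((e.arrowCongr (Equiv.refl _)).subtypeEquiv fun f => ?_)
  rw [← edgesConnect_comp_equiv e, ← e.forall_congr_right]
  simp [Function.comp_def]

theorem numConnecting_of_isEmpty [IsEmpty ι] [Subsingleton Q] (π : V → Q) (r : ι → ℕ) :
    numConnecting π r = 1 :=
  Nat.card_eq_one_iff_unique.2 ⟨inferInstance,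
    ⟨⟨isEmptyElim, isEmptyElim, (edgesConnect_iff_subsingleton _).2 ‹_›⟩⟩⟩

theorem numConnecting_eq_zero [Fintype ι] [Fintype Q] (π : V → Q) {r : ι → ℕ}
    (h : ∑ i, r i + 1 < Fintype.card Q) : numConnecting π r = 0 := by
  refine Nat.card_eq_zero.2 (.inl ⟨fun ⟨f, hf, hconn⟩ => h.not_ge ?_⟩)
  calc Fintype.card Q ≤ 1 + ∑ i, (#((f i).image π) - 1) :=
        hconn.card_le fun i => (card_pos.1 (by rw [hf i]; omega)).image π
    _ ≤ 1 + ∑ i, r i := by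
        gcongr with i
        exact Nat.sub_le_of_le_add (card_image_le.trans (hf i).le)
    _ = ∑ i, r i + 1 := add_comm _ _

variable [Fintype V]

theorem numConnecting_option [Finite ι] (π : V → Q) (r : Option ι → ℕ) :
    numConnecting π r = ∑ e ∈ powersetCard (r none + 1) (univ : Finset V),
      numConnecting (contract (e.image π) ∘ π) (r ∘ some) := by
  have image_nonempty {e : Finset V} (he : #e = r none + 1) : (e.image π).Nonempty :=
    (card_pos.1 (by omega)).image π
  let split : {f : Option ι → Finset V //
      (∀ i, #(f i) = r i + 1) ∧ EdgesConnect fun i => (f i).image π} ≃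
      (e : {e : Finset V // #e = r none + 1}) × {f : ι → Finset V //
        (∀ i, #(f i) = (r ∘ some) i + 1) ∧
          EdgesConnect fun i => (f i).image (contract (e.1.image π) ∘ π)} :=
    { toFun f := ⟨⟨f.1 none, f.2.1 none⟩, fun i => f.1 (some i), fun i => f.2.1 (some i), by
        simpa only [image_image] using
          (edgesConnect_option_iff (image_nonempty (f.2.1 none))).1 f.2.2⟩
      invFun p := ⟨fun i => i.elim p.1.1 p.2.1, Option.forall.2 ⟨p.1.2, p.2.2.1⟩, by
        refine (edgesConnect_option_iff (image_nonempty p.1.2)).2 ?_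
        have connect := p.2.2.2
        simp only [← image_image] at connect
        exact connect⟩
      left_inv f := Subtype.ext (funext (Option.forall.2 ⟨rfl, fun _ => rfl⟩))
      right_inv _ := rfl }
  rw [numConnecting, Nat.card_congr split, Nat.card_sigma]
  exact (sum_subtype _ (fun _ => mem_powersetCard_univ)
    fun e => numConnecting (contract (e.image π) ∘ π) (r ∘ some)).symm

/-- The number of vertices over `q`, that is, the number of vertices merged into `q` by the
quotient map `π`. -/
def fibreCard (π : V → Q) (q : Q) : ℕ := #{v | π v = q}

theorem sum_fibreCard [Fintype Q] (π : V → Q) : ∑ q, fibreCard π q = Fintype.card V :=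
  (card_eq_sum_card_fiberwise fun _ _ => mem_univ _).symm

theorem fibreCard_id [DecidableEq V] (v : V) : fibreCard id v = 1 := by
  simp [fibreCard, filter_eq']

theorem card_transversals (π : V → Q) (S : Finset Q) :
    #{e : Finset V | e.image π = S ∧ #e = #S} = ∏ q ∈ S, fibreCard π q := by
  classical
  have image_section (g : (q : S) → {v // π v = q}) :
      (univ.image fun q => (g q : V)).image π = S := by
    rw [image_image, show π ∘ (fun q => (g q : V)) = Subtype.val from funext fun q => (g q).2]
    exact S.attach_image_val
  have section_injective (g : (q : S) → {v // π v = q}) :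
      Function.Injective fun q => (g q : V) := fun q r h => by
    rw [Subtype.ext_iff, ← (g q).2, ← (g r).2]
    exact congrArg π h
  let range (g : (q : S) → {v // π v = q}) : {e : Finset V // e.image π = S ∧ #e = #S} :=
    ⟨univ.image fun q => (g q : V), image_section g, by
      rw [card_image_of_injective _ (section_injective g), card_univ, Fintype.card_coe]⟩
  have range_bijective : Function.Bijective range := by
    refine ⟨fun g g' h => funext fun q => Subtype.ext ?_, fun ⟨e, he, hcard⟩ => ?_⟩
    · have range_eq : (univ.image fun q => (g q : V)) = univ.image fun q => (g' q : V) :=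
        congrArg Subtype.val h
      obtain ⟨r, -, hr⟩ := mem_image.1 (range_eq ▸ mem_image_of_mem _ (mem_univ q))
      obtain rfl : r = q := Subtype.ext <| by rw [← (g q).2, ← (g' r).2, hr]
      exact hr.symm
    · have exists_over (q : S) : ∃ v ∈ e, π v = q := mem_image.1 (he ▸ q.2)
      choose g hge hgπ using exists_over
      refine ⟨fun q => ⟨g q, hgπ q⟩, Subtype.ext (eq_of_subset_of_card_le ?_ ?_)⟩
      · exact fun v hv => by
          obtain ⟨q, -, rfl⟩ := mem_image.1 hv
          exact hge q
      · exact (hcard.trans (range _).2.2.symm).le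
  rw [← Fintype.card_subtype, ← Fintype.card_of_bijective range_bijective, Fintype.card_pi,
    ← prod_coe_sort S]
  simp only [Fintype.card_subtype, fibreCard]

theorem sum_transversals [Fintype Q] {A : Type*} [AddCommMonoid A] (π : V → Q) (s : ℕ)
    (G : Finset Q → A) :
    ∑ e ∈ powersetCard s (univ : Finset V) with #(e.image π) = s, G (e.image π) =
      ∑ S ∈ powersetCard s (univ : Finset Q), (∏ q ∈ S, fibreCard π q) • G S := by
  rw [← sum_fiberwise_of_maps_to (t := powersetCard s univ) (g := image π)
    fun e he => mem_powersetCard_univ.2 (mem_filter.1 he).2]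
  refine sum_congr rfl fun S hS => ?_
  rw [sum_congr rfl (g := fun _ => G S) fun e he => by rw [(mem_filter.1 he).2], sum_const,
    ← card_transversals]
  congr 2
  ext e
  simp only [mem_filter, mem_powersetCard_univ, mem_univ, true_and] at hS ⊢
  grind

theorem sum_powersetCard_sum {α A : Type*} [Fintype α] [AddCommMonoid A] (s : ℕ) (a : α → A) :
    ∑ S ∈ powersetCard (s + 1) (univ : Finset α), ∑ q ∈ S, a q =
      (Fintype.card α - 1).choose s • ∑ q, a q := by
  classical
  have card_containing (q : α) :
      #{S ∈ powersetCard (s + 1) univ | q ∈ S} = (Fintype.card α - 1).choose s := by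
    simpa using card_filter_powersetCard_subset {q} univ (s + 1) (subset_univ _) (by simp)
  rw [sum_comm' (t' := univ) (s' := fun q => {S ∈ powersetCard (s + 1) univ | q ∈ S}) (by simp),
    smul_sum]
  simp only [sum_const, card_containing]

theorem prod_fibreCard_contract [Fintype Q] (π : V → Q) (S : Finset Q) :
    ∏ q, fibreCard (contract S ∘ π) q =
      (∑ q ∈ S, fibreCard π q) * ∏ q ∈ Sᶜ, fibreCard π q := by
  rw [Fintype.prod_option, prod_subtype (F := inferInstance) Sᶜ (p := (· ∉ S)) fun _ => mem_compl]
  simp only [fibreCard, Function.comp_apply, contract_eq_none_iff, contract_eq_some_iff]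
  refine congrArg (· * _) ?_
  rw [card_eq_sum_card_fiberwise (f := π) (t := S) fun v hv => by simpa using hv]
  refine sum_congr rfl fun q hq => ?_
  congr 1
  ext v
  grind

theorem sum_prod_fibreCard_contract [Fintype Q] (π : V → Q) (s : ℕ) :
    ∑ e ∈ powersetCard (s + 1) (univ : Finset V) with #(e.image π) = s + 1,
        ∏ q, fibreCard (contract (e.image π) ∘ π) q =
      (∏ q, fibreCard π q) * Fintype.card V * (Fintype.card Q - 1).choose s := by
  rw [sum_transversals π (s + 1) fun S => ∏ q, fibreCard (contract S ∘ π) q, mul_assoc,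
    ← sum_fibreCard π, mul_comm (∑ q, _), ← smul_eq_mul (Nat.choose _ _),
    ← sum_powersetCard_sum, mul_sum]
  refine sum_congr rfl fun S _ => ?_
  rw [prod_fibreCard_contract, ← prod_mul_prod_compl S, smul_eq_mul]
  ring

theorem numConnecting_option_eq_sum_transversals [Fintype ι] [Fintype Q] (π : V → Q)
    {r : Option ι → ℕ} (h : ∑ i, r i + 1 = Fintype.card Q) :
    numConnecting π r =
      ∑ e ∈ powersetCard (r none + 1) (univ : Finset V) with #(e.image π) = r none + 1,
        numConnecting (contract (e.image π) ∘ π) (r ∘ some) := by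
  rw [numConnecting_option, sum_filter_of_ne]
  intro e he hne
  by_contra hcard
  refine hne (numConnecting_eq_zero _ ?_)
  have image_le : #(e.image π) ≤ r none + 1 := card_image_le.trans (mem_powersetCard.1 he).2.le
  have := card_contract_add_card (e.image π)
  rw [Fintype.sum_option] at h
  simp only [Function.comp_apply]
  omega

theorem numConnecting_option_mul [Fintype ι] [Fintype Q] (π : V → Q) {r : Option ι → ℕ}
    (h : ∑ i, r i + 1 = Fintype.card Q) {c : ℕ}
    (hc : ∀ e : Finset V, #(e.image π) = r none + 1 →
      numConnecting (contract (e.image π) ∘ π) (r ∘ some) * (∏ i, (r (some i))!) *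
        Fintype.card V = (∏ q, fibreCard (contract (e.image π) ∘ π) q) * c) :
    numConnecting π r * (∏ i, (r i)!) * Fintype.card V =
      (∏ q, fibreCard π q) * Fintype.card V * (Fintype.card Q - 1).choose (r none) * c *
        (r none)! := by
  rw [numConnecting_option_eq_sum_transversals π h, Fintype.prod_option]
  calc _ = (∑ e ∈ powersetCard (r none + 1) (univ : Finset V) with #(e.image π) = r none + 1,
          numConnecting (contract (e.image π) ∘ π) (r ∘ some) * (∏ i, (r (some i))!) *
            Fintype.card V) * (r none)! := by
        rw [← sum_mul, ← sum_mul]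
        ring
    _ = _ := by
        rw [sum_congr rfl fun e he => hc e (mem_filter.1 he).2, ← sum_mul,
          sum_prod_fibreCard_contract]

theorem numConnecting_mul [Fintype ι] [Fintype Q] (π : V → Q) {r : ι → ℕ}
    (h : ∑ i, r i + 1 = Fintype.card Q) :
    numConnecting π r * (∏ i, (r i)!) * Fintype.card V =
      (∏ q, fibreCard π q) * Fintype.card V ^ Fintype.card ι * (∑ i, r i)! := by
  revert Q
  refine Fintype.induction_empty_option (P := fun ι _ => ∀ {r : ι → ℕ} {Q} [DecidableEq Q]
    [Fintype Q] (π : V → Q), ∑ i, r i + 1 = Fintype.card Q →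
      numConnecting π r * (∏ i, (r i)!) * Fintype.card V =
        (∏ q, fibreCard π q) * Fintype.card V ^ Fintype.card ι * (∑ i, r i)!) ?_ ?_ ?_ ι
  · intro ι κ _ e ih r Q _ _ π h
    let := Fintype.ofEquiv κ e.symm
    simp only [← numConnecting_comp_equiv π e, ← e.prod_comp, ← e.sum_comp,
      ← Fintype.card_congr e] at h ⊢
    exact ih π h
  · intro r Q _ _ π h
    obtain ⟨_⟩ := Fintype.card_eq_one_iff_nonempty_unique.1 (by simpa using h.symm)
    simp [numConnecting_of_isEmpty, ← sum_fibreCard π]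
  · intro ι _ ih r Q _ _ π h
    have hQ : Fintype.card Q - 1 = r none + ∑ i, r (some i) := by
      rw [← h, Nat.add_sub_cancel, Fintype.sum_option]
    rw [numConnecting_option_mul π h (c := Fintype.card V ^ Fintype.card ι * (∑ i, r (some i))!)
      fun e he => ?_, hQ, Fintype.sum_option, Fintype.card_option,
      ← Nat.add_choose_mul_factorial_mul_factorial (r none), Nat.choose_symm_add]
    · ring
    · have := card_contract_add_card (e.image π)
      rw [← mul_assoc]
      refine ih _ ?_
      simp only [Function.comp_apply]
      omega

end Counting

section EdgeNumbers

theorem LabeledHypergraph.connected_iff_edgesConnect {n : ℕ} (hn : 0 < n) {ℓ : ℕ →₀ ℕ}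
    (H : LabeledHypergraph n ℓ) :
    H.Connected ↔ EdgesConnect fun x : (i : ℕ) × Fin (ℓ i) => H.edge x.1 x.2 := by
  simp only [EdgesConnect, Sigma.exists]
  exact and_iff_right hn

theorem numConnected_toFinsupp {n : ℕ} (hn : 0 < n) {M : Multiset ℕ} (hM : ∀ i ∈ M, 2 ≤ i) :
    numConnected n (Multiset.toFinsupp M) =
      numConnecting (id : Fin n → Fin n) fun x : M => x.1 - 1 := by
  have two_le (x : M) : 2 ≤ x.1 := hM _ Multiset.coe_mem
  have pred_add_one (x : M) : x.1 - 1 + 1 = x.1 := Nat.sub_add_cancel (one_le_two.trans (two_le x))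
  simp only [numConnecting, image_id, pred_add_one]
  exact Nat.card_congr
    { toFun H := ⟨fun x => H.1.edge x.1 x.2, fun x => H.1.card_edge x.1 x.2,
        (H.1.connected_iff_edgesConnect hn).1 H.2⟩
      invFun f := ⟨⟨fun i j => f.1 ⟨i, j⟩, fun i j => f.2.1 ⟨i, j⟩,
          fun i j => (two_le ⟨i, j⟩).trans_eq (f.2.1 ⟨i, j⟩).symm⟩,
        (LabeledHypergraph.connected_iff_edgesConnect hn _).2 f.2.2⟩
      left_inv _ := rfl
      right_inv _ := rfl }

theorem two_le_of_numConnected_ne_zero {n : ℕ} {ℓ : ℕ →₀ ℕ} (h : numConnected n ℓ ≠ 0) {i : ℕ}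
    (hi : i ∈ ℓ.support) : 2 ≤ i := by
  obtain ⟨⟨H, -⟩⟩ := (Nat.card_ne_zero.1 h).1
  let j : Fin (ℓ i) := ⟨0, Nat.pos_of_ne_zero (Finsupp.mem_support_iff.1 hi)⟩
  exact (H.two_le_card_edge i j).trans_eq (H.card_edge i j)

/-- The edge numbers of the hypergraphs that have, for each part `k` of the partition `m`, an edge
of size `k + 1`. -/
noncomputable def edgeNumbers (m : Multiset ℕ) : ℕ →₀ ℕ := Multiset.toFinsupp (m.map (· + 1))

theorem edgeNumbers_injective : Function.Injective edgeNumbers :=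
  Multiset.toFinsupp.injective.comp (Multiset.map_injective (add_left_injective 1))

theorem magnitude_toFinsupp (M : Multiset ℕ) :
    magnitude (Multiset.toFinsupp M) = (M.map (· - 1)).sum := by
  simp [magnitude, Finsupp.sum, sum_multiset_map_count, mul_comm]

theorem magnitude_edgeNumbers (m : Multiset ℕ) : magnitude (edgeNumbers m) = m.sum := by
  simp [edgeNumbers, magnitude_toFinsupp]

theorem numConnected_edgeNumbers_mul {n : ℕ} {m : Multiset ℕ} (hm : ∀ k ∈ m, 0 < k)
    (h : m.sum + 1 = n) :
    numConnected n (edgeNumbers m) * (m.map (· !)).prod * n = n ^ m.card * (n - 1)! := by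
  subst h
  have two_le : ∀ i ∈ m.map (· + 1), 2 ≤ i := by
    simpa using fun k hk => Nat.succ_le_of_lt (hm k hk)
  have sum_eq : ∑ x : (m.map (· + 1) : Multiset ℕ), (x.1 - 1) = m.sum :=
    (congrArg Multiset.sum (Multiset.map_univ _ (· - 1))).trans (by simp)
  have prod_eq : ∏ x : (m.map (· + 1) : Multiset ℕ), (x.1 - 1)! = (m.map (· !)).prod :=
    (congrArg Multiset.prod (Multiset.map_univ _ fun i => (i - 1)!)).trans (by simp)
  have key := numConnecting_mul (id : Fin (m.sum + 1) → Fin (m.sum + 1))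
    (r := fun x : (m.map (· + 1) : Multiset ℕ) => x.1 - 1) (by rw [sum_eq, Fintype.card_fin])
  rw [edgeNumbers, numConnected_toFinsupp m.sum.succ_pos two_le, Nat.add_sub_cancel]
  simpa only [sum_eq, prod_eq, fibreCard_id, prod_const_one, one_mul, Fintype.card_fin,
    Multiset.card_coe, Multiset.card_map] using key

theorem exists_partition_edgeNumbers_eq {n : ℕ} {ℓ : ℕ →₀ ℕ} (h : numConnected n ℓ ≠ 0)
    (hmagnitude : magnitude ℓ + 1 = n) :
    ∃ p : Nat.Partition (n - 1), edgeNumbers p.parts = ℓ := by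
  obtain ⟨M, rfl⟩ := Multiset.toFinsupp.surjective ℓ
  have hM : ∀ i ∈ M, 2 ≤ i := fun i hi =>
    two_le_of_numConnected_ne_zero h (by simpa using hi)
  rw [magnitude_toFinsupp] at hmagnitude
  refine ⟨⟨M.map (· - 1), fun {k} hk => ?_, by omega⟩, congrArg Multiset.toFinsupp ?_⟩
  · obtain ⟨i, hi, rfl⟩ := Multiset.mem_map.1 hk
    exact Nat.sub_pos_of_lt (hM i hi)
  · rw [Multiset.map_map]
    exact (Multiset.map_congr rfl fun i hi => Nat.sub_add_cancel (one_le_two.trans (hM i hi))).trans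
      M.map_id'

end EdgeNumbers

section GeneratingFunctions

theorem factorial_smul_one_div_factorial_smul (n : ℕ) (x : Coeffs) :
    (n ! : ℚ) • (1 / (n ! : ℚ)) • x = x := by
  rw [one_div, smul_inv_smul₀ (Nat.cast_ne_zero.2 n.factorial_ne_zero)]

theorem egfCoeff_T (n : ℕ) : egfCoeff n T = leadingPart n := by
  rw [egfCoeff, T, PowerSeries.coeff_mk, factorial_smul_one_div_factorial_smul]

theorem egfCoeff_R (n : ℕ) : egfCoeff n R = (n : ℚ) • egfCoeff n T := by
  cases n with
  | zero => simp [egfCoeff, R]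
  | succ n =>
    rw [egfCoeff, egfCoeff, R, PowerSeries.coeff_succ_X_mul, PowerSeries.coeff_derivative,
      smul_comm, ← Nat.cast_add_one, mul_comm, ← nsmul_eq_mul,
      Nat.cast_smul_eq_nsmul ℚ (n + 1)]

theorem egfCoeff_T_eq_smul {n : ℕ} (hn : 1 ≤ n) :
    egfCoeff n T = (1 / (n : ℚ)) • egfCoeff n R := by
  rw [egfCoeff_R, one_div, inv_smul_smul₀ (Nat.cast_ne_zero.2 (Nat.ne_zero_of_lt hn))]

theorem coeff_egfCoeff_C (n : ℕ) (ℓ : ℕ →₀ ℕ) :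
    MvPowerSeries.coeff ℓ (egfCoeff n C) =
      (numConnected n ℓ : ℚ) / ℓ.prod fun _ k => (k ! : ℚ) := by
  have egfCoeff_C : egfCoeff n C =
      fun ℓ : ℕ →₀ ℕ => (numConnected n ℓ : ℚ) / ℓ.prod fun _ k => (k ! : ℚ) :=
    (congrArg _ (PowerSeries.coeff_mk _ _)).trans (factorial_smul_one_div_factorial_smul n _)
  rw [egfCoeff_C]
  rfl

theorem coeff_leadingPart (n : ℕ) (ℓ : ℕ →₀ ℕ) :
    MvPowerSeries.coeff ℓ (leadingPart n) = if magnitude ℓ + 1 = n then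
      (numConnected n ℓ : ℚ) / ℓ.prod fun _ k => (k ! : ℚ) else 0 :=
  if_congr Iff.rfl (coeff_egfCoeff_C n ℓ) rfl

theorem eq_sum_monomial_of_injective {α σ A : Type*} [Fintype α] [Semiring A] {g : α → σ →₀ ℕ}
    (hg : Function.Injective g) {f : MvPowerSeries σ A}
    (hf : ∀ ℓ, MvPowerSeries.coeff ℓ f ≠ 0 → ℓ ∈ Set.range g) :
    f = ∑ a, MvPowerSeries.monomial (g a) (MvPowerSeries.coeff (g a) f) := by
  classical
  ext ℓ
  simp only [map_sum, MvPowerSeries.coeff_monomial]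
  by_cases hℓ : ℓ ∈ Set.range g
  · obtain ⟨a, rfl⟩ := hℓ
    simp [hg.eq_iff]
  · rw [not_not.1 (mt (hf ℓ) hℓ), sum_eq_zero fun a _ => if_neg fun h => hℓ ⟨a, h.symm⟩]

theorem prod_map_u_add_one (m : Multiset ℕ) :
    (m.map fun k => u (k + 1)).prod = MvPowerSeries.monomial (edgeNumbers m) 1 := by
  induction m using Multiset.induction_on with
  | empty => simp [edgeNumbers]
  | cons k m ih =>
    rw [Multiset.map_cons, Multiset.prod_cons, ih, u, MvPowerSeries.X,
      MvPowerSeries.monomial_mul_monomial, one_mul, edgeNumbers, edgeNumbers, Multiset.map_cons,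
      ← Multiset.singleton_add, map_add, Multiset.toFinsupp_singleton]

/-- The coefficient of `u ^ edgeNumbers m` in `[t ^ n / n!] T`, for a partition `m` of `n - 1`. -/
noncomputable def hypertreeWeight (n : ℕ) (m : Multiset ℕ) : ℚ :=
  n ^ m.card * (n - 1)! / (n * ((m.map (· !)).prod * ∏ k ∈ m.toFinset, (m.count k)! : ℕ))

theorem prod_edgeNumbers {A : Type*} [CommMonoid A] (m : Multiset ℕ) (h : ℕ → A) :
    ((edgeNumbers m).prod fun _ c => h c) = ∏ k ∈ m.toFinset, h (m.count k) := by
  classical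
  rw [Finsupp.prod, edgeNumbers, Multiset.toFinsupp_support, Multiset.toFinset_map,
    prod_image (add_left_injective 1).injOn]
  simp [Multiset.count_map_eq_count' _ _ (add_left_injective 1)]

theorem numConnected_div_eq_hypertreeWeight {n : ℕ} {m : Multiset ℕ} (hm : ∀ k ∈ m, 0 < k)
    (h : m.sum + 1 = n) :
    (numConnected n (edgeNumbers m) : ℚ) / (edgeNumbers m).prod (fun _ c => (c ! : ℚ)) =
      hypertreeWeight n m := by
  have count : (numConnected n (edgeNumbers m) * (m.map (· !)).prod * n : ℚ) =
    n ^ m.card * (n - 1)! := mod_cast numConnected_edgeNumbers_mul hm h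
  have hn : (n : ℚ) ≠ 0 := by
    rw [← h]
    positivity
  have prod_parts : ((m.map (· !)).prod : ℚ) ≠ 0 := by
    simp [Multiset.prod_eq_zero_iff, Nat.factorial_ne_zero]
  rw [hypertreeWeight, ← count, prod_edgeNumbers m fun c => (c ! : ℚ)]
  rw [Nat.cast_mul, Nat.cast_prod]
  field_simp

theorem egfCoeff_T_eq_sum {n : ℕ} (hn : 1 ≤ n) :
    egfCoeff n T = ∑ p : Nat.Partition (n - 1),
      hypertreeWeight n p.parts • (p.parts.map fun k => u (k + 1)).prod := by
  have support : ∀ ℓ, MvPowerSeries.coeff ℓ (leadingPart n) ≠ 0 →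
      ∃ p : Nat.Partition (n - 1), edgeNumbers p.parts = ℓ := fun ℓ hℓ => by
    rw [coeff_leadingPart] at hℓ
    split_ifs at hℓ with hmagnitude
    · exact exists_partition_edgeNumbers_eq
        (fun h => hℓ (by rw [h, Nat.cast_zero, zero_div])) hmagnitude
    · contradiction
  rw [egfCoeff_T, eq_sum_monomial_of_injective (f := leadingPart n)
    (edgeNumbers_injective.comp fun p q => Nat.Partition.ext) support]
  refine sum_congr rfl fun p _ => ?_
  have hp : p.parts.sum + 1 = n := by rw [p.parts_sum, Nat.sub_add_cancel hn]
  rw [Function.comp_apply, coeff_leadingPart, magnitude_edgeNumbers, if_pos hp,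
    numConnected_div_eq_hypertreeWeight (fun _ => p.parts_pos) hp, prod_map_u_add_one,
    ← map_smul, smul_eq_mul, mul_one]

theorem multinomialOfParts_smul_prod {n : ℕ} (hn : 1 ≤ n) (p : Nat.Partition (n - 1)) :
    multinomialOfParts p • ∏ i ∈ Icc 1 (n - 1), (1 / ((p.parts.count i)! : ℚ)) •
        ((n : Coeffs) * u (i + 1)) ^ p.parts.count i =
      (n : ℚ) • hypertreeWeight n p.parts • (p.parts.map fun k => u (k + 1)).prod := by
  have parts_subset : p.parts.toFinset ⊆ Icc 1 (n - 1) := fun i hi => by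
    rw [Multiset.mem_toFinset] at hi
    exact mem_Icc.2 ⟨p.parts_pos hi, p.le_of_mem_parts hi⟩
  have cast_n : (n : Coeffs) = algebraMap ℚ Coeffs n := (map_natCast _ n).symm
  rw [← prod_subset parts_subset fun i _ hi => by
      rw [Multiset.mem_toFinset, ← Multiset.count_eq_zero] at hi
      simp [hi]]
  simp only [mul_pow, prod_smul, prod_mul_distrib, prod_pow_eq_pow_sum,
    Multiset.toFinset_sum_count_eq, ← prod_multiset_map_count, cast_n]
  rw [← map_pow, ← Algebra.smul_def, smul_smul, smul_smul, smul_smul]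
  congr 1
  rw [multinomialOfParts, hypertreeWeight]
  rw [Nat.cast_mul, Nat.cast_prod, Nat.cast_multiset_prod, Multiset.map_map, prod_div_distrib]
  have : (n : ℚ) ≠ 0 := Nat.cast_ne_zero.2 (by omega)
  field_simp
  simp

theorem egfCoeff_R_eq_sum {n : ℕ} (hn : 1 ≤ n) :
    egfCoeff n R = ∑ p : Nat.Partition (n - 1), multinomialOfParts p •
      ∏ i ∈ Icc 1 (n - 1), (1 / ((p.parts.count i)! : ℚ)) •
        ((n : Coeffs) * u (i + 1)) ^ p.parts.count i := by
  rw [egfCoeff_R, egfCoeff_T_eq_sum hn, smul_sum]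
  exact sum_congr rfl fun p _ => (multinomialOfParts_smul_prod hn p).symm

end GeneratingFunctions

section SmallPartitions

/-- The multisets of sum `n` all of whose elements lie between `1` and `k`; unlike
`Nat.Partition n`, this can be enumerated by kernel reduction. -/
def partitionsUpTo : ℕ → ℕ → Finset (Multiset ℕ)
  | 0, n => if n = 0 then {0} else ∅
  | k + 1, n => (range (n / (k + 1) + 1)).biUnion fun c =>
      (partitionsUpTo k (n - c * (k + 1))).image (Multiset.replicate c (k + 1) + ·)

theorem mem_partitionsUpTo {k n : ℕ} {m : Multiset ℕ} :
    m ∈ partitionsUpTo k n ↔ m.sum = n ∧ ∀ i ∈ m, 0 < i ∧ i ≤ k := by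
  induction k generalizing m n with
  | zero =>
    have forall_iff : (∀ i ∈ m, 0 < i ∧ i ≤ 0) ↔ m = 0 :=
      ⟨fun h => Multiset.eq_zero_of_forall_notMem fun i hi => (h i hi).1.not_ge (h i hi).2,
        by simp +contextual⟩
    rw [partitionsUpTo, forall_iff]
    split_ifs with hn
    · simp +contextual [hn]
    · refine iff_of_false (notMem_empty m) ?_
      rintro ⟨rfl, rfl⟩
      exact hn Multiset.sum_zero
  | succ k ih =>
    simp only [partitionsUpTo, mem_biUnion, mem_range, mem_image, ih]
    constructor
    · rintro ⟨c, hc, m, ⟨hsum, hm⟩, rfl⟩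
      have := (Nat.le_div_iff_mul_le k.succ_pos).1 (Nat.le_of_lt_succ hc)
      refine ⟨?_, fun i hi => ?_⟩
      · rw [Multiset.sum_add, Multiset.sum_replicate, hsum, smul_eq_mul, Nat.add_sub_cancel' this]
      rcases Multiset.mem_add.1 hi with hi | hi
      · obtain rfl := Multiset.eq_of_mem_replicate hi
        omega
      · have := hm i hi
        omega
    · rintro ⟨rfl, hm⟩
      have split := Multiset.filter_add_not (k + 1 = ·) m
      rw [Multiset.filter_eq] at split
      have sum_split := congrArg Multiset.sum split
      rw [Multiset.sum_add, Multiset.sum_replicate, smul_eq_mul] at sum_split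
      refine ⟨m.count (k + 1), Nat.lt_succ_of_le ((Nat.le_div_iff_mul_le k.succ_pos).2
          (Nat.le_of_add_right_le sum_split.le)), m.filter (¬ k + 1 = ·),
        ⟨by rw [← sum_split, Nat.add_sub_cancel_left], fun i hi => ?_⟩, split⟩
      obtain ⟨him, hne⟩ := Multiset.mem_filter.1 hi
      have := hm i him
      omega

theorem sum_parts_eq_sum_partitionsUpTo {A : Type*} [AddCommMonoid A] {n : ℕ}
    (F : Multiset ℕ → A) :
    ∑ p : Nat.Partition n, F p.parts = ∑ m ∈ partitionsUpTo n n, F m :=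
  sum_bij' (fun p _ => p.parts)
    (fun m hm => ⟨m, fun hi => ((mem_partitionsUpTo.1 hm).2 _ hi).1, (mem_partitionsUpTo.1 hm).1⟩)
    (fun p _ => mem_partitionsUpTo.2
      ⟨p.parts_sum, fun _ hi => ⟨p.parts_pos hi, p.le_of_mem_parts hi⟩⟩)
    (fun _ _ => mem_univ _) (fun _ _ => rfl) (fun _ _ => rfl) fun _ _ => rfl

theorem egfCoeff_succ_T (n : ℕ) :
    egfCoeff (n + 1) T = ∑ m ∈ partitionsUpTo n n,
      hypertreeWeight (n + 1) m • (m.map fun k => u (k + 1)).prod := by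
  rw [egfCoeff_T_eq_sum n.succ_pos]
  exact sum_parts_eq_sum_partitionsUpTo fun m =>
    hypertreeWeight (n + 1) m • (m.map fun k => u (k + 1)).prod

theorem ofNat_smul_eq_mul (k : ℕ) [k.AtLeastTwo] (x : Coeffs) :
    (ofNat(k) : ℚ) • x = ofNat(k) * x := by
  rw [MvPowerSeries.smul_eq_C_mul, map_ofNat]

theorem egfCoeff_one_T : egfCoeff 1 T = 1 := by
  simp [egfCoeff_succ_T, show partitionsUpTo 0 0 = {0} by decide, hypertreeWeight]

theorem egfCoeff_two_T : egfCoeff 2 T = u 2 := by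
  simp [egfCoeff_succ_T, show partitionsUpTo 1 1 = {{1}} by decide, hypertreeWeight]

theorem egfCoeff_three_T : egfCoeff 3 T = u 3 + 3 * u 2 ^ 2 := by
  rw [egfCoeff_succ_T, show partitionsUpTo 2 2 = {{2}, {1, 1}} by decide]
  norm_num +decide [hypertreeWeight, Nat.factorial, ofNat_smul_eq_mul, sq]

theorem egfCoeff_four_T : egfCoeff 4 T = u 4 + 12 * u 2 * u 3 + 16 * u 2 ^ 3 := by
  rw [egfCoeff_succ_T, show partitionsUpTo 3 3 = {{3}, {1, 2}, {1, 1, 1}} by decide]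
  norm_num +decide [hypertreeWeight, Nat.factorial, ofNat_smul_eq_mul]
  ring

theorem egfCoeff_five_T : egfCoeff 5 T =
    u 5 + 20 * u 2 * u 4 + 15 * u 3 ^ 2 + 150 * u 3 * u 2 ^ 2 + 125 * u 2 ^ 4 := by
  rw [egfCoeff_succ_T, show partitionsUpTo 4 4 =
    {{4}, {1, 3}, {2, 2}, {1, 1, 2}, {1, 1, 1, 1}} by decide]
  norm_num +decide [hypertreeWeight, Nat.factorial, ofNat_smul_eq_mul]
  ring

theorem egfCoeff_six_T : egfCoeff 6 T =
    u 6 + 30 * u 2 * u 5 + 60 * u 4 * u 3 + 360 * u 4 * u 2 ^ 2 + 540 * u 2 * u 3 ^ 2 +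
      2160 * u 3 * u 2 ^ 3 + 1296 * u 2 ^ 5 := by
  rw [egfCoeff_succ_T, show partitionsUpTo 5 5 =
    {{5}, {1, 4}, {2, 3}, {1, 1, 3}, {1, 2, 2}, {1, 1, 1, 2}, {1, 1, 1, 1, 1}} by decide]
  norm_num +decide [hypertreeWeight, Nat.factorial, ofNat_smul_eq_mul]
  ring

end SmallPartitions

end Hyper

theorem mainTheorem7 :
    (∀ n : ℕ, 1 ≤ n →
      Hyper.egfCoeff n Hyper.R =
        ∑ p : Nat.Partition (n - 1), Hyper.multinomialOfParts p •
          ∏ i ∈ Finset.Icc 1 (n - 1),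
            (1 / ((p.parts.count i)! : ℚ)) •
              ((n : Hyper.Coeffs) * Hyper.u (i + 1)) ^ (p.parts.count i)) ∧
    (∀ n : ℕ, 1 ≤ n →
      Hyper.egfCoeff n Hyper.T = (1 / (n : ℚ)) • Hyper.egfCoeff n Hyper.R) ∧
    Hyper.egfCoeff 1 Hyper.T = 1 ∧
    Hyper.egfCoeff 2 Hyper.T = Hyper.u 2 ∧
    Hyper.egfCoeff 3 Hyper.T = Hyper.u 3 + 3 * Hyper.u 2 ^ 2 ∧
    Hyper.egfCoeff 4 Hyper.T =
      Hyper.u 4 + 12 * Hyper.u 2 * Hyper.u 3 + 16 * Hyper.u 2 ^ 3 ∧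
    Hyper.egfCoeff 5 Hyper.T =
      Hyper.u 5 + 20 * Hyper.u 2 * Hyper.u 4 + 15 * Hyper.u 3 ^ 2
        + 150 * Hyper.u 3 * Hyper.u 2 ^ 2 + 125 * Hyper.u 2 ^ 4 ∧
    Hyper.egfCoeff 6 Hyper.T =
      Hyper.u 6 + 30 * Hyper.u 2 * Hyper.u 5 + 60 * Hyper.u 4 * Hyper.u 3
        + 360 * Hyper.u 4 * Hyper.u 2 ^ 2 + 540 * Hyper.u 2 * Hyper.u 3 ^ 2
        + 2160 * Hyper.u 3 * Hyper.u 2 ^ 3 + 1296 * Hyper.u 2 ^ 5 :=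
  ⟨fun _ => Hyper.egfCoeff_R_eq_sum, fun _ => Hyper.egfCoeff_T_eq_smul, Hyper.egfCoeff_one_T,
    Hyper.egfCoeff_two_T, Hyper.egfCoeff_three_T, Hyper.egfCoeff_four_T, Hyper.egfCoeff_five_T,
    Hyper.egfCoeff_six_T⟩
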